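/- Let $p>2$ be a prime, $m>1$ an integer, $N=2(p^m-1)/(p-1)$, and let $\omega$ be a primitive element of $\mathbb{F}_{p^m}$ (a generator of $\mathbb{F}_{p^m}^{\times}$). For $n\ge 0$ let $c_n=\left(\frac{\mathrm{Tr}_{\mathbb{F}_{p^m}/\mathbb{F}_p}(\omega^n)}{p}\right)\in\{1,-1,0\}$ (Legendre symbol). Define sequences $T^{(1)}=(t^{(1)}_n)_{n\ge0}$ and $T^{(2)}=(t^{(2)}_n)_{n\ge0}$ over $\mathbb{F}_2$ by $t^{(1)}_n=t^{(2)}_n=0$ if $c_n=1$, $t^{(1)}_n=t^{(2)}_n=1$ if $c_n=-1$, and $t^{(1)}_n=0$, $t^{(2)}_n=1$ if $c_n=0$. For $e\in\{0,1,\dots,N-1\}$ let $S^e=(s^e_n)_{n\ge0}$ be the interleaved sequence of $T^{(1)}$ and of $T^{(2)}$ shifted to the left by $e$, that is, $s^e_{2j}=t^{(1)}_j$ and $s^e_{2j+1}=t^{(2)}_{j+e}$ for $j\ge 0$. The linear complexity $L(S)$ of a sequence $S=(s_n)_{n\ge0}$ over $\mathbb{F}_2$ is the least $L\ge0$ for which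 there are $a_0,\dots,a_{L-1}\in\mathbb{F}_2$ with $s_{n+L}=a_{L-1}s_{n+L-1}+\cdots+a_0s_n$ for all $n\ge0$. Let $2^{\nu_2(N)}$ be the largest power of $2$ that divides $N$, put $N'=N/2^{\nu_2(N)}$, and let $G(N,e)=\gcd(N',u)$, where $u\in\{1,\dots,N'\}$ is the integer with $u\equiv-2e+1\pmod{N'}$. Then: 1. $L(S^e)\le 2N-1$, with equality if and only if $G(N,e)=1$. 2. $L(S^e)\ge 2N-N/2^{\nu_2(N)}$, with equality if and only if $-2e+1\equiv0\pmod{N/2^{\nu_2(N)}}$. -/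

import Mathlib

namespace InterleavedGeometric

/-- The linear complexity of a sequence over a field: the least order `L` of a linear recurrence
`s (n + L) = ∑ i : Fin L, a i * s (n + i)`, valid for all `n ≥ 0`, which the sequence satisfies.
(Every periodic sequence satisfies one.) -/
noncomputable def linearComplexity {F : Type*} [Field F] (s : ℕ → F) : ℕ :=
  sInf {L : ℕ | ∃ E : LinearRecurrence F, E.order = L ∧ E.IsSolution s}

/-- The interleaved sequence of a family of `T` sequences: its term at `n = j * T + i`,
with `0 ≤ i < T`, is the `j`-th term of the `i`-th sequence. -/
def interleave {α : Type*} {T : ℕ} [NeZero T] (s : Fin T → ℕ → α) : ℕ → α :=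
  fun n => s (Fin.ofNat T n) (n / T)

/-- The left shift of a sequence by `e` positions. -/
def leftShift {α : Type*} (e : ℕ) (s : ℕ → α) : ℕ → α :=
  fun n => s (n + e)

/-- The Legendre symbol of the trace of `ω ^ n` from `K` down to the field with `p` elements. -/
noncomputable def traceSymbol (p : ℕ) [Fact p.Prime] {K : Type*} [Field K] [Algebra (ZMod p) K]
    (ω : K) (n : ℕ) : ℤ :=
  quadraticChar (ZMod p) (Algebra.trace (ZMod p) K (ω ^ n))

/-- The geometric sequence of the first type: the symbols `1, -1, 0` become `0, 1, 0`. -/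
noncomputable def geomSeqOne (p : ℕ) [Fact p.Prime] {K : Type*} [Field K] [Algebra (ZMod p) K]
    (ω : K) : ℕ → ZMod 2 :=
  fun n => if traceSymbol p ω n = 1 then 0 else if traceSymbol p ω n = -1 then 1 else 0

/-- The geometric sequence of the second type: the symbols `1, -1, 0` become `0, 1, 1`. -/
noncomputable def geomSeqTwo (p : ℕ) [Fact p.Prime] {K : Type*} [Field K] [Algebra (ZMod p) K]
    (ω : K) : ℕ → ZMod 2 :=
  fun n => if traceSymbol p ω n = 1 then 0 else if traceSymbol p ω n = -1 then 1 else 1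

/-- The interleaved sequence of the first geometric sequence and of the second one,
shifted to the left by `e`. -/
noncomputable def interleavedSeq (p : ℕ) [Fact p.Prime] {K : Type*} [Field K]
    [Algebra (ZMod p) K] (ω : K) (e : ℕ) : ℕ → ZMod 2 :=
  interleave ![geomSeqOne p ω, leftShift e (geomSeqTwo p ω)]

/-- The largest odd divisor of a positive integer. -/
def oddPart (N : ℕ) : ℕ := N / 2 ^ padicValNat 2 N

/-- For `n ≥ 1`, the integer in `{1, …, n}` that is congruent to `a` modulo `n`. -/
def posMod (a : ℤ) (n : ℕ) : ℕ :=
  if a % (n : ℤ) = 0 then n else (a % (n : ℤ)).toNat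

/-- The greatest common divisor of the odd part `N'` of `N` and of the representative
of `-2e + 1` in `{1, …, N'}`. -/
def G (N e : ℕ) : ℕ :=
  Nat.gcd (oddPart N) (posMod (-2 * (e : ℤ) + 1) (oddPart N))

end InterleavedGeometric

/-!
Put `M = (p ^ m - 1) / (p - 1)`, so that `N = 2 * M` and `ω ^ M` generates the units of the prime
field. The linear complexity turns out to be exactly `2 * N - G N e`; both bounds and their
equality cases follow, since `G N e` is a divisor of the odd part `N'` of `N`, equal to `N'` if and
only if `N'` divides `-2 * e + 1`.

The minimal polynomial of a sequence `s` of period `P` is `(X ^ P - 1) / gcd (X ^ P - 1, S)`, where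
`S` is the polynomial whose coefficients are one period of `s` (`linearComplexity_eq_sub`). The
coefficients are taken in decreasing order, so that the shift acts as multiplication by `X`. For the
interleaved sequence, `P = 2 * N` and `S = X * A (X ^ 2) + B (X ^ 2)`, with `A` and `B` the
polynomials of the two geometric sequences, the second one shifted. In characteristic two a root
`β` of `X ^ (2 * N) - 1` satisfies `β ^ N' = 1`, hence also `β ^ M = 1`.

Since `ω ^ M` is a nonsquare of the prime field, the symbols change sign after `M` steps. Hence, in
both geometric sequences, the terms at `n` and at `n + M` differ exactly when the trace of `ω ^ n` is
not zero, and at an `M`-th root of unity `A` and the unshifted `B` have the same value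
(`aeval_revPoly_of_add_eq`). So `S β = (β + β ^ (2 * e)) * A (β ^ 2)`, while the derivative of `S` at
`β` is `A (β ^ 2)`. That value is, up to a unit, the sum of the powers of a root of unity over the
support of the trace, which in characteristic two is a Gauss sum of `K`. It does not vanish because
the cardinality of `K` is odd (`sum_trace_support_ne_zero`). The common roots of `S` and
`X ^ (2 * N) - 1` are thus simple roots of `S`, and they are the `β` with `β ^ N' = 1` and
`β ^ (1 - 2 * e) = 1`, that is, the `G N e`-th roots of unity.
-/

namespace InterleavedGeometric

open Polynomial Finset

/-! ### Linear complexity of periodic sequences -/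

section LinearComplexity

variable {F : Type*} [Field F]

/-- The left shift by one position, as an endomorphism of the space of sequences. A polynomial
in it is a linear recurrence operator with constant coefficients. -/
def shiftEnd (F : Type*) [Field F] : Module.End F (ℕ → F) :=
  LinearMap.funLeft F F Nat.succ

theorem shiftEnd_pow_apply (i : ℕ) (s : ℕ → F) (n : ℕ) :
    (shiftEnd F ^ i) s n = s (n + i) := by
  induction i generalizing n with
  | zero => simp
  | succ i ih =>
    rw [pow_succ', Module.End.mul_apply]
    change (shiftEnd F ^ i) s (n + 1) = _
    rw [ih]
    congr 1
    omega

theorem isSolution_iff_aeval_charPoly (E : LinearRecurrence F) (s : ℕ → F) :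
    E.IsSolution s ↔ aeval (shiftEnd F) E.charPoly s = 0 := by
  have key : ∀ n, aeval (shiftEnd F) E.charPoly s n =
      s (n + E.order) - ∑ i, E.coeffs i * s (n + i) := by
    intro n
    simp [LinearRecurrence.charPoly, aeval_monomial, shiftEnd_pow_apply, LinearMap.sum_apply]
  simp only [LinearRecurrence.IsSolution, funext_iff, key, Pi.zero_apply, sub_eq_zero]

/-- Every monic polynomial is the characteristic polynomial of a linear recurrence. -/
theorem exists_charPoly_eq {f : F[X]} (hf : f.Monic) :
    ∃ E : LinearRecurrence F, E.order = f.natDegree ∧ E.charPoly = f := by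
  refine ⟨⟨f.natDegree, fun i => -f.coeff i⟩, rfl, ?_⟩
  conv_rhs => rw [hf.as_sum]
  simp only [LinearRecurrence.charPoly, map_neg, sum_neg_distrib, sub_neg_eq_add,
    ← C_mul_X_pow_eq_monomial, C_1, one_mul]
  rw [Fin.sum_univ_eq_sum_range (fun i => C (f.coeff i) * X ^ i)]

/-- The first `P` terms of a sequence as the coefficients of a polynomial, in decreasing order:
with this order the left shift of a `P`-periodic sequence becomes multiplication by `X` modulo
`X ^ P - 1`. -/
noncomputable def revPoly (P : ℕ) (s : ℕ → F) : F[X] :=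
  ∑ j ∈ range P, C (s j) * X ^ (P - 1 - j)

theorem coeff_revPoly {P j : ℕ} (hj : j < P) (s : ℕ → F) :
    (revPoly P s).coeff (P - 1 - j) = s j := by
  simp only [revPoly, finsetSum_coeff, coeff_C_mul, coeff_X_pow]
  rw [sum_eq_single_of_mem j (mem_range.2 hj)]
  · simp
  · intro b hb hbj
    rw [mem_range] at hb
    rw [if_neg (by omega), mul_zero]

theorem degree_revPoly_lt {P : ℕ} (hP : 0 < P) (s : ℕ → F) :
    (revPoly P s).degree < P := by
  refine lt_of_le_of_lt (degree_sum_le _ _) ?_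
  rw [Finset.sup_lt_iff (by exact WithBot.bot_lt_coe P)]
  intro j _
  refine lt_of_le_of_lt (degree_C_mul_X_pow_le _ _) ?_
  exact_mod_cast (by omega : P - 1 - j < P)

theorem X_mul_revPoly (P : ℕ) (s : ℕ → F) :
    X * revPoly P s = ∑ j ∈ range P, C (s j) * X ^ (P - j) := by
  rw [revPoly, mul_sum]
  refine sum_congr rfl fun j hj => ?_
  rw [mem_range] at hj
  rw [show P - j = (P - 1 - j) + 1 by omega, pow_succ]
  ring

theorem dvd_revPoly_shiftEnd_sub {P : ℕ} {s : ℕ → F} (hs : Function.Periodic s P) :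
    (X ^ P - 1 : F[X]) ∣ revPoly P (shiftEnd F s) - X * revPoly P s := by
  have h1 : revPoly P (shiftEnd F s) = ∑ j ∈ range P, C (s (j + 1)) * X ^ (P - (j + 1)) := by
    refine sum_congr rfl fun j _ => ?_
    rw [Nat.sub_sub, add_comm 1 j]
    rfl
  have h2 := sum_range_succ (fun j => C (s j) * X ^ (P - j) : ℕ → F[X]) P
  rw [sum_range_succ', ← h1, ← X_mul_revPoly] at h2
  have h3 : s P = s 0 := by simpa using hs 0
  simp only [Nat.sub_zero, Nat.sub_self, pow_zero, mul_one, h3] at h2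
  exact ⟨-C (s 0), by linear_combination h2⟩

theorem revPoly_add (P : ℕ) (s t : ℕ → F) :
    revPoly P (s + t) = revPoly P s + revPoly P t := by
  simp [revPoly, sum_add_distrib, add_mul]

theorem revPoly_smul (P : ℕ) (c : F) (s : ℕ → F) :
    revPoly P (c • s) = C c * revPoly P s := by
  simp [revPoly, mul_sum, mul_assoc]

theorem periodic_shiftEnd {P : ℕ} {s : ℕ → F} (hs : Function.Periodic s P) :
    Function.Periodic (shiftEnd F s) P := fun n => by
  change s (n + P + 1) = s (n + 1)
  rw [← hs (n + 1)]
  congr 1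
  omega

/-- Applying a polynomial in the shift to a periodic sequence multiplies its polynomial by that
polynomial, modulo `X ^ P - 1`. -/
theorem periodic_aeval_and_dvd {P : ℕ} {s : ℕ → F} (hs : Function.Periodic s P) (f : F[X]) :
    Function.Periodic (aeval (shiftEnd F) f s) P ∧
      (X ^ P - 1 : F[X]) ∣ revPoly P (aeval (shiftEnd F) f s) - f * revPoly P s := by
  induction f using Polynomial.induction_on with
  | C a =>
    simp only [aeval_C, Module.algebraMap_end_apply, revPoly_smul, sub_self, dvd_zero, and_true]
    intro n
    simp [hs n]
  | add f g hf hg =>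
    simp only [map_add, LinearMap.add_apply, revPoly_add]
    refine ⟨fun n => by simp [hf.1 n, hg.1 n], ?_⟩
    convert dvd_add hf.2 hg.2 using 1
    ring
  | monomial n a h =>
    have hX : aeval (shiftEnd F) (C a * X ^ (n + 1)) s =
        shiftEnd F (aeval (shiftEnd F) (C a * X ^ n) s) := by
      rw [pow_succ, ← mul_assoc, mul_comm, map_mul, aeval_X, Module.End.mul_apply]
    rw [hX]
    refine ⟨periodic_shiftEnd h.1, ?_⟩
    convert dvd_add (dvd_revPoly_shiftEnd_sub h.1) (h.2.mul_left X) using 1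
    ring

/-- The annihilator of a periodic sequence, read off modulo `X ^ P - 1`. -/
theorem aeval_shiftEnd_eq_zero_iff {P : ℕ} (hP : 0 < P) {s : ℕ → F}
    (hs : Function.Periodic s P) (f : F[X]) :
    aeval (shiftEnd F) f s = 0 ↔ (X ^ P - 1 : F[X]) ∣ f * revPoly P s := by
  obtain ⟨hper, hdvd⟩ := periodic_aeval_and_dvd hs f
  rw [← dvd_iff_dvd_of_dvd_sub hdvd]
  constructor
  · intro h
    simp [h, revPoly]
  · intro h
    have h0 := eq_zero_of_dvd_of_degree_lt h <| by
      rw [← C_1, degree_X_pow_sub_C hP]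
      exact degree_revPoly_lt hP _
    funext n
    rw [← hper.map_mod_nat n,
      ← coeff_revPoly (Nat.mod_lt n hP) (aeval (shiftEnd F) f s), h0]
    simp

/-- If `D` is a greatest common divisor of `X ^ P - 1` and the polynomial of a `P`-periodic
sequence, the minimal polynomial of the sequence is `(X ^ P - 1) / D`. -/
theorem linearComplexity_eq_sub {P : ℕ} (hP : 0 < P) {s : ℕ → F}
    (hs : Function.Periodic s P) {D Q H : F[X]} (hD : D.Monic) (hQ : X ^ P - 1 = D * Q)
    (hH : revPoly P s = D * H) (hQH : IsCoprime Q H) :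
    linearComplexity s = P - D.natDegree := by
  have hmon : (X ^ P - 1 : F[X]).Monic := by
    rw [← C_1]; exact monic_X_pow_sub_C 1 hP.ne'
  have hQm : Q.Monic := hD.of_mul_monic_left (hQ ▸ hmon)
  have hdeg : D.natDegree + Q.natDegree = P := by
    rw [← hD.natDegree_mul hQm, ← hQ, ← C_1, natDegree_X_pow_sub_C]
  have hann : ∀ f : F[X], aeval (shiftEnd F) f s = 0 ↔ Q ∣ f := by
    intro f
    rw [aeval_shiftEnd_eq_zero_iff hP hs, hQ, hH, mul_left_comm,
      mul_dvd_mul_iff_left hD.ne_zero]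
    exact ⟨hQH.dvd_of_dvd_mul_right, fun h => h.mul_right H⟩
  rw [show P - D.natDegree = Q.natDegree by omega]
  refine IsLeast.csInf_eq ⟨?_, ?_⟩
  · obtain ⟨E, hE, hEQ⟩ := exists_charPoly_eq hQm
    exact ⟨E, hE, by rw [isSolution_iff_aeval_charPoly, hEQ, hann]⟩
  · rintro _ ⟨E, rfl, hE⟩
    rw [isSolution_iff_aeval_charPoly, hann] at hE
    rw [← natDegree_eq_of_degree_eq_some E.charPoly_degree_eq_order]
    exact natDegree_le_of_dvd hE E.charPoly_monic.ne_zero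

/-- The linear complexity of a `P`-periodic sequence for which the common roots of its
polynomial and `X ^ P - 1` are simple roots of the former and are the `g`-th roots of unity. -/
theorem linearComplexity_eq_sub_of_roots (E : Type*) [Field E] [Algebra F E] [IsAlgClosed E]
    {P g : ℕ} (hP : 0 < P) (hgP : g ∣ P) (hg : (g : F) ≠ 0) {s : ℕ → F}
    (hs : Function.Periodic s P)
    (hroot : ∀ β : E, β ^ P = 1 → (aeval β (revPoly P s) = 0 ↔ β ^ g = 1))
    (hsimple : ∀ β : E, β ^ P = 1 → aeval β (derivative (revPoly P s)) ≠ 0) :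
    linearComplexity s = P - g := by
  have hg0 : g ≠ 0 := by rintro rfl; simp at hg
  have : NeZero g := ⟨hg0⟩
  have hgE : (g : E) ≠ 0 := by
    rw [← map_natCast (algebraMap F E)]
    exact (_root_.map_ne_zero _).2 hg
  have : NeZero (g : E) := ⟨hgE⟩
  obtain ⟨ζ, hζ⟩ := HasEnoughRootsOfUnity.exists_primitiveRoot E g
  have hdvd : (X ^ g - 1 : F[X]) ∣ revPoly P s := by
    rw [← Polynomial.map_dvd_map' (algebraMap F E), Polynomial.map_sub, Polynomial.map_pow,
      map_X, Polynomial.map_one, X_pow_sub_one_eq_prod (Nat.pos_of_ne_zero hg0) hζ]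
    refine Finset.prod_dvd_of_coprime ?_ fun β hβ => ?_
    · intro a _ b _ hab
      exact pairwise_coprime_X_sub_C Function.injective_id hab
    · rw [mem_nthRootsFinset (Nat.pos_of_ne_zero hg0)] at hβ
      obtain ⟨k, rfl⟩ := hgP
      rw [dvd_iff_isRoot, IsRoot.def, eval_map_algebraMap, hroot β (by rw [pow_mul, hβ, one_pow])]
      exact hβ
  obtain ⟨H, hH⟩ := hdvd
  obtain ⟨Q, hQ⟩ : (X ^ g - 1 : F[X]) ∣ X ^ P - 1 := by
    obtain ⟨k, rfl⟩ := hgP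
    exact pow_one_sub_dvd_pow_mul_sub_one X g k
  have hDm : (X ^ g - 1 : F[X]).Monic := by rw [← C_1]; exact monic_X_pow_sub_C 1 hg0
  have hDd : (X ^ g - 1 : F[X]).natDegree = g := by rw [← C_1, natDegree_X_pow_sub_C]
  rw [linearComplexity_eq_sub hP hs hDm hQ hH, hDd]
  rw [isCoprime_iff_aeval_ne_zero_of_isAlgClosed F E]
  intro β
  by_contra! hβ
  have hβP : β ^ P = 1 := by
    have := congrArg (aeval β) hQ
    simp only [map_sub, map_pow, aeval_X, map_one, map_mul, hβ.1, mul_zero, sub_eq_zero] at this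
    exact this
  have hβg : β ^ g = 1 := by
    rw [← hroot β hβP, hH, map_mul, hβ.2, mul_zero]
  -- a common root of the two cofactors would be a double root of the polynomial of `s`
  refine hsimple β hβP ?_
  rw [hH, derivative_mul, map_add, map_mul, map_mul, hβ.2]
  simp [hβg]

end LinearComplexity

/-! ### A Gauss sum as a sum over the support of the trace -/

section GaussSum

theorem sum_range_mul_eq {R : Type*} [AddCommMonoid R] (f : ℕ → R) (a b : ℕ) :
    ∑ n ∈ range (a * b), f n = ∑ r ∈ range a, ∑ k ∈ range b, f (a * k + r) := by
  rw [sum_comm]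
  induction b with
  | zero => simp
  | succ b ih => rw [Nat.mul_succ, sum_range_add, sum_range_succ, ih]

theorem sum_eq_add_sum_primitiveRoot_pow {F R : Type*} [Field F] [Fintype F] [AddCommMonoid R]
    {ω : F} {k : ℕ} (hω : IsPrimitiveRoot ω k) (hk : Fintype.card F = k + 1) (f : F → R) :
    ∑ x, f x = f 0 + ∑ n ∈ range k, f (ω ^ n) := by
  classical
  have hk0 : k ≠ 0 := by
    have := Fintype.one_lt_card (α := F)
    omega
  have hinj : Set.InjOn (fun n => ω ^ n) (range k : Set ℕ) := fun a ha b hb hab =>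
    hω.pow_inj (by simpa using ha) (by simpa using hb) hab
  have h0 : (0 : F) ∉ (range k).image (fun n => ω ^ n) := by
    simp only [mem_image, not_exists, not_and]
    exact fun n _ => pow_ne_zero n (hω.ne_zero hk0)
  have huniv : (univ : Finset F) = insert 0 ((range k).image (fun n => ω ^ n)) := by
    symm
    rw [← card_eq_iff_eq_univ, card_insert_of_notMem h0, card_image_of_injOn hinj,
      card_range, hk]
  rw [huniv, sum_insert h0, sum_image hinj]

/-- A generator of the units of a finite field can be sent by a multiplicative character to any
root of unity of the right order. -/
theorem exists_mulChar_apply_eq {K E : Type*} [Field K] [Fintype K] [Field E] {ω : K} {k : ℕ}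
    (hω : IsPrimitiveRoot ω k) (hk : Fintype.card K = k + 1) {β : E} (hβ : β ^ k = 1) :
    ∃ χ : MulChar K E, χ ω = β := by
  classical
  have hk0 : k ≠ 0 := by
    have := Fintype.one_lt_card (α := K)
    omega
  have hcard : Fintype.card Kˣ = k := by
    rw [Fintype.card_units, hk, Nat.add_sub_cancel]
  have hβ0 : β ≠ 0 := by
    rintro rfl
    simp [hk0] at hβ
  obtain ⟨g, rfl⟩ : IsUnit ω := hω.isUnit hk0
  have hg : ∀ x, x ∈ Subgroup.zpowers g := by
    intro x
    have hord : Nat.card (Subgroup.zpowers g) = Nat.card Kˣ := by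
      rw [Nat.card_zpowers, Nat.card_eq_fintype_card, hcard]
      exact (IsPrimitiveRoot.coe_units_iff.1 hω).eq_orderOf.symm
    rw [(Subgroup.card_eq_iff_eq_top _).1 hord]
    trivial
  have hroot : Units.mk0 β hβ0 ∈ rootsOfUnity (Fintype.card Kˣ) E := by
    rw [mem_rootsOfUnity, hcard]
    ext
    simpa using hβ
  exact ⟨MulChar.ofRootOfUnity hroot hg, by rw [MulChar.ofRootOfUnity_spec]; rfl⟩

theorem gaussSum_ne_zero_of_isPrimitive {K E : Type*} [Field K] [Fintype K] [Field E]
    (hcard : (Fintype.card K : E) ≠ 0) (χ : MulChar K E) {ψ : AddChar K E}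
    (hψ : ψ.IsPrimitive) : gaussSum χ ψ ≠ 0 := by
  by_cases hχ : χ = 1
  · subst hχ
    have hψ1 : ψ ≠ 1 := by
      have := hψ one_ne_zero
      rwa [AddChar.mulShift_one] at this
    rw [gaussSum_one_left hψ1]
    exact neg_ne_zero.2 one_ne_zero
  · exact left_ne_zero_of_mul (b := gaussSum χ⁻¹ ψ⁻¹)
      (by rw [gaussSum_mul_gaussSum_eq_card hχ hψ]; exact hcard)

variable {p : ℕ} [Fact p.Prime] {K : Type*} [Field K] [Algebra (ZMod p) K]

/-- The power of a primitive element that generates the units of the prime field. -/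
theorem exists_primitiveRoot_algebraMap_eq {ω : K} {M : ℕ}
    (hω : IsPrimitiveRoot ω (M * (p - 1))) (hM : 0 < M) :
    ∃ g : ZMod p, IsPrimitiveRoot g (p - 1) ∧ algebraMap (ZMod p) K g = ω ^ M := by
  have hp2 := (Fact.out : p.Prime).two_le
  have hωM : IsPrimitiveRoot (ω ^ M) (p - 1) :=
    hω.pow (Nat.mul_pos hM (by omega)) rfl
  obtain ⟨u, hu⟩ := IsCyclic.exists_ofOrder_eq_natCard (α := (ZMod p)ˣ)
  have hinj := (algebraMap (ZMod p) K).injective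
  rw [Nat.card_eq_fintype_card, ZMod.card_units p] at hu
  have hu' : IsPrimitiveRoot (algebraMap (ZMod p) K u) (p - 1) :=
    (IsPrimitiveRoot.coe_units_iff.2 (hu ▸ IsPrimitiveRoot.orderOf u)).map_of_injective hinj
  have : NeZero (p - 1) := ⟨by omega⟩
  obtain ⟨i, -, hi⟩ := hu'.eq_pow_of_pow_eq_one hωM.pow_eq_one
  have hi' : algebraMap (ZMod p) K (u ^ i) = ω ^ M := by rw [map_pow, hi]
  refine ⟨u ^ i, ?_, hi'⟩
  rw [← hi'] at hωM
  exact hωM.of_map_of_injective hinj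

theorem trace_pow_add_eq {ω : K} {M : ℕ} {g : ZMod p}
    (hg : algebraMap (ZMod p) K g = ω ^ M) (n k : ℕ) :
    Algebra.trace (ZMod p) K (ω ^ (M * k + n)) =
      g ^ k * Algebra.trace (ZMod p) K (ω ^ n) := by
  rw [pow_add, pow_mul, ← hg, ← map_pow, ← Algebra.smul_def, map_smul, smul_eq_mul]

/-- In characteristic two, the sum of `β ^ r` over the `r` in a period at which the trace of
`ω ^ r` does not vanish is the Gauss sum of the multiplicative character `ω ↦ β`. Since the product
of this sum with its conjugate is a power of the odd prime `p`, it is not zero. -/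
theorem sum_trace_support_ne_zero [Fintype K] (hp : 2 < p) {E : Type*} [Field E] [CharP E 2]
    [IsAlgClosed E] {ω : K} {M : ℕ} (hω : IsPrimitiveRoot ω (M * (p - 1)))
    (hcard : Fintype.card K = M * (p - 1) + 1) {β : E} (hβ : β ^ M = 1) :
    ∑ r ∈ range M, (if Algebra.trace (ZMod p) K (ω ^ r) = 0 then 0 else β ^ r) ≠ 0 := by
  have hprime : p.Prime := Fact.out
  have hM : 0 < M := by
    rcases Nat.eq_zero_or_pos M with rfl | h
    · have := Fintype.one_lt_card (α := K)
      omega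
    · exact h
  have hodd : Odd p := hprime.odd_of_ne_two (by omega)
  have hcastodd : ∀ n : ℕ, Odd n → (n : E) = 1 := by
    rintro _ ⟨k, rfl⟩
    simp [CharTwo.two_eq_zero]
  have hcasteven : ((p - 1 : ℕ) : E) = 0 := by
    rw [Nat.cast_sub hprime.one_le, hcastodd p hodd, Nat.cast_one, sub_self]
  obtain ⟨g, hg, hgω⟩ := exists_primitiveRoot_algebraMap_eq hω hM
  have : NeZero (p : E) := ⟨by rw [hcastodd p hodd]; exact one_ne_zero⟩
  obtain ⟨ζ, hζ⟩ := HasEnoughRootsOfUnity.exists_primitiveRoot E p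
  set ψ₀ : AddChar (ZMod p) E := AddChar.zmodChar p ((IsPrimitiveRoot.iff_def ζ p).mp hζ).left
  have hψ₀p : ψ₀.IsPrimitive := AddChar.zmodChar_primitive_of_primitive_root p hζ
  set ψ : AddChar K E := ψ₀.compAddMonoidHom (Algebra.trace (ZMod p) K).toAddMonoidHom
  have hψp : ψ.IsPrimitive := by
    refine AddChar.IsPrimitive.of_ne_one fun h => ?_
    have h1 : ψ₀ = 1 := by
      ext a
      obtain ⟨x, rfl⟩ := Algebra.trace_surjective (ZMod p) K a
      exact DFunLike.congr_fun h x
    have := hψ₀p one_ne_zero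
    rw [AddChar.mulShift_one] at this
    exact this h1
  obtain ⟨χ, hχ⟩ := exists_mulChar_apply_eq (E := E) hω hcard
    (β := β) (by rw [pow_mul, hβ, one_pow])
  have hqE : (Fintype.card K : E) ≠ 0 := by
    rw [hcard, Nat.cast_add, Nat.cast_mul, hcasteven, mul_zero, zero_add, Nat.cast_one]
    exact one_ne_zero
  -- the inner sums run over the multiples of one trace by all units of the prime field
  have hinner : ∀ t : ZMod p, ∑ k ∈ range (p - 1), ψ₀ (g ^ k * t) = if t = 0 then 0 else 1 := by
    intro t
    split_ifs with ht
    · simp [ht, hcasteven]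
    · have h1 := sum_eq_add_sum_primitiveRoot_pow hg
        (by rw [ZMod.card]; omega) (fun a => ψ₀ (a * t))
      rw [AddChar.sum_mulShift t hψ₀p, if_neg ht, zero_mul, AddChar.map_zero_eq_one] at h1
      simp only [Nat.cast_zero] at h1
      rw [← CharTwo.add_eq_zero]
      rw [add_comm]
      exact h1.symm
  have key : gaussSum χ ψ =
      ∑ r ∈ range M, (if Algebra.trace (ZMod p) K (ω ^ r) = 0 then 0 else β ^ r) := by
    rw [gaussSum, sum_eq_add_sum_primitiveRoot_pow hω hcard, MulChar.map_zero, zero_mul, zero_add,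
      sum_range_mul_eq]
    refine sum_congr rfl fun r _ => ?_
    have hterm : ∀ k, χ (ω ^ (M * k + r)) * ψ (ω ^ (M * k + r)) =
        β ^ r * ψ₀ (g ^ k * Algebra.trace (ZMod p) K (ω ^ r)) := by
      intro k
      rw [← trace_pow_add_eq hgω, map_pow, hχ, pow_add, pow_mul, hβ, one_pow, one_mul]
      rfl
    simp only [hterm, ← mul_sum, hinner, mul_ite, mul_zero, mul_one]
  rw [← key]
  exact gaussSum_ne_zero_of_isPrimitive hqE χ hψp

end GaussSum

/-! ### Values of the polynomials of shifted and interleaved sequences -/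

section Values

variable {F E : Type*} [Field F] [Field E] [Algebra F E]

theorem aeval_revPoly_eq_sum {P : ℕ} {β : E} (hβ : β ^ P = 1) (s : ℕ → F) :
    aeval β (revPoly P s) = β⁻¹ * ∑ j ∈ range P, algebraMap F E (s j) * β⁻¹ ^ j := by
  rw [revPoly, map_sum, mul_sum]
  refine sum_congr rfl fun j hj => ?_
  rw [mem_range] at hj
  have hβ0 : β ≠ 0 := by
    rintro rfl
    rw [zero_pow (by omega)] at hβ
    exact zero_ne_one hβ
  have h1 : β ^ (P - 1 - j) * (β * β ^ j) = 1 := by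
    rw [← pow_succ', ← pow_add, show P - 1 - j + (j + 1) = P by omega, hβ]
  rw [map_mul, aeval_C, map_pow, aeval_X, eq_inv_of_mul_eq_one_left h1, mul_inv, inv_pow]
  ring

theorem aeval_revPoly_leftShift {P : ℕ} {β : E} (hβ : β ^ P = 1) {s : ℕ → F}
    (hs : Function.Periodic s P) (e : ℕ) :
    aeval β (revPoly P (leftShift e s)) = β ^ e * aeval β (revPoly P s) := by
  have h1 : leftShift e s = aeval (shiftEnd F) (X ^ e : F[X]) s := by
    funext n
    rw [map_pow, aeval_X, shiftEnd_pow_apply]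
    rfl
  obtain ⟨c, hc⟩ := (periodic_aeval_and_dvd hs (X ^ e)).2
  rw [← h1] at hc
  have h2 := congrArg (aeval β) hc
  simp only [map_sub, map_mul, map_pow, aeval_X, map_one, hβ, sub_self, zero_mul] at h2
  exact sub_eq_zero.1 h2

theorem interleave_two_mul {α : Type*} (a b : ℕ → α) (n : ℕ) :
    interleave ![a, b] (2 * n) = a n := by
  have h : Fin.ofNat 2 (2 * n) = 0 := Fin.ext (by simp)
  have h' : 2 * n / 2 = n := by omega
  rw [interleave, h, h']
  rfl

theorem interleave_two_mul_add_one {α : Type*} (a b : ℕ → α) (n : ℕ) :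
    interleave ![a, b] (2 * n + 1) = b n := by
  have h : Fin.ofNat 2 (2 * n + 1) = 1 := Fin.ext (by simp)
  have h' : (2 * n + 1) / 2 = n := by omega
  rw [interleave, h, h']
  rfl

theorem periodic_interleave {α : Type*} {a b : ℕ → α} {P : ℕ} (ha : Function.Periodic a P)
    (hb : Function.Periodic b P) : Function.Periodic (interleave ![a, b]) (2 * P) := by
  intro n
  obtain ⟨k, rfl | rfl⟩ := n.even_or_odd'
  · rw [← mul_add, interleave_two_mul, interleave_two_mul, ha]
  · rw [show 2 * k + 1 + 2 * P = 2 * (k + P) + 1 by ring, interleave_two_mul_add_one,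
      interleave_two_mul_add_one, hb]

theorem revPoly_interleave (P : ℕ) (a b : ℕ → F) :
    revPoly (2 * P) (interleave ![a, b]) =
      X * expand F 2 (revPoly P a) + expand F 2 (revPoly P b) := by
  simp only [revPoly]
  rw [sum_range_mul_eq, sum_range_succ, sum_range_one, map_sum,
    map_sum, mul_sum]
  congr 1 <;> refine sum_congr rfl fun j hj => ?_ <;> rw [mem_range] at hj
  · rw [add_zero, interleave_two_mul, map_mul, expand_C, map_pow, expand_X, ← pow_mul,
      show 2 * P - 1 - 2 * j = 2 * (P - 1 - j) + 1 by omega, pow_succ]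
    ring
  · rw [interleave_two_mul_add_one, map_mul, expand_C, map_pow, expand_X, ← pow_mul,
      show 2 * P - 1 - (2 * j + 1) = 2 * (P - 1 - j) by omega]

theorem derivative_expand_two [CharP F 2] (f : F[X]) : derivative (expand F 2 f) = 0 := by
  have h : ((2 : ℕ) : F[X]) = 0 := CharP.cast_eq_zero F[X] 2
  rw [derivative_expand, h]
  simp

end Values

/-! ### The geometric sequences -/

section Geometric

variable {p : ℕ} [Fact p.Prime] {K : Type*} [Field K] [Algebra (ZMod p) K]

theorem quadraticChar_eq_neg_one_of_primitiveRoot (hp : 2 < p) {g : ZMod p}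
    (hg : IsPrimitiveRoot g (p - 1)) : quadraticChar (ZMod p) g = -1 := by
  rw [quadraticChar_neg_one_iff_not_isSquare]
  rintro ⟨h, rfl⟩
  have hh : h ≠ 0 := by
    rintro rfl
    exact hg.ne_zero (by omega) (zero_mul 0)
  obtain ⟨k, hk⟩ := (Fact.out : p.Prime).odd_of_ne_two (by omega)
  have h1 : (h * h) ^ k = 1 := by
    rw [← pow_two, ← pow_mul, show 2 * k = p - 1 by omega, ZMod.pow_card_sub_one_eq_one hh]
  have := Nat.le_of_dvd (by omega) (hg.dvd_of_pow_eq_one k h1)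
  omega

variable {ω : K} {M : ℕ}

theorem traceSymbol_add (hp : 2 < p) (hM : 0 < M) (hω : IsPrimitiveRoot ω (M * (p - 1)))
    (n : ℕ) : traceSymbol p ω (n + M) = -traceSymbol p ω n := by
  obtain ⟨g, hg, hgω⟩ := exists_primitiveRoot_algebraMap_eq hω hM
  have h := trace_pow_add_eq hgω n 1
  rw [mul_one, add_comm, pow_one] at h
  rw [traceSymbol, traceSymbol, h, map_mul, quadraticChar_eq_neg_one_of_primitiveRoot hp hg,
    neg_one_mul]

theorem traceSymbol_cases (ω : K) (n : ℕ) :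
    (Algebra.trace (ZMod p) K (ω ^ n) = 0 ∧ traceSymbol p ω n = 0) ∨
      Algebra.trace (ZMod p) K (ω ^ n) ≠ 0 ∧
        (traceSymbol p ω n = 1 ∨ traceSymbol p ω n = -1) := by
  by_cases h : Algebra.trace (ZMod p) K (ω ^ n) = 0
  · exact Or.inl ⟨h, by rw [traceSymbol, h, quadraticChar_zero]⟩
  · exact Or.inr ⟨h, quadraticChar_dichotomy h⟩

theorem geomSeqOne_add (hp : 2 < p) (hM : 0 < M) (hω : IsPrimitiveRoot ω (M * (p - 1)))
    (n : ℕ) : geomSeqOne p ω (n + M) =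
      geomSeqOne p ω n + if Algebra.trace (ZMod p) K (ω ^ n) = 0 then 0 else 1 := by
  simp only [geomSeqOne, traceSymbol_add hp hM hω]
  rcases traceSymbol_cases (p := p) ω n with ⟨h, hc⟩ | ⟨h, hc | hc⟩ <;> simp [h, hc]
  decide

theorem geomSeqTwo_add (hp : 2 < p) (hM : 0 < M) (hω : IsPrimitiveRoot ω (M * (p - 1)))
    (n : ℕ) : geomSeqTwo p ω (n + M) =
      geomSeqTwo p ω n + if Algebra.trace (ZMod p) K (ω ^ n) = 0 then 0 else 1 := by
  simp only [geomSeqTwo, traceSymbol_add hp hM hω]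
  rcases traceSymbol_cases (p := p) ω n with ⟨h, hc⟩ | ⟨h, hc | hc⟩ <;> simp [h, hc]
  decide

theorem trace_pow_add_eq_zero_iff (hp : 2 < p) (hM : 0 < M)
    (hω : IsPrimitiveRoot ω (M * (p - 1))) (n : ℕ) :
    Algebra.trace (ZMod p) K (ω ^ (n + M)) = 0 ↔ Algebra.trace (ZMod p) K (ω ^ n) = 0 := by
  have h := traceSymbol_add hp hM hω n
  rw [← quadraticChar_eq_zero_iff, ← quadraticChar_eq_zero_iff]
  change traceSymbol p ω (n + M) = 0 ↔ traceSymbol p ω n = 0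
  rw [h, neg_eq_zero]

theorem periodic_of_add_eq (hp : 2 < p) (hM : 0 < M) (hω : IsPrimitiveRoot ω (M * (p - 1)))
    {t : ℕ → ZMod 2}
    (ht : ∀ n, t (n + M) = t n + if Algebra.trace (ZMod p) K (ω ^ n) = 0 then 0 else 1) :
    Function.Periodic t (2 * M) := by
  intro n
  rw [two_mul, ← add_assoc, ht, ht]
  simp only [trace_pow_add_eq_zero_iff hp hM hω]
  rw [add_assoc, CharTwo.add_self_eq_zero, add_zero]

/-- At an `M`-th root of unity the polynomial of either geometric sequence depends only on the
difference between the two halves of the period, which is the indicator of a nonzero trace. -/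
theorem aeval_revPoly_of_add_eq {E : Type*} [Field E] [Algebra (ZMod 2) E] {t : ℕ → ZMod 2}
    (ht : ∀ n, t (n + M) = t n + if Algebra.trace (ZMod p) K (ω ^ n) = 0 then 0 else 1)
    {β : E} (hβ : β ^ M = 1) :
    aeval β (revPoly (2 * M) t) = β⁻¹ * ∑ r ∈ range M,
      (if Algebra.trace (ZMod p) K (ω ^ r) = 0 then 0 else β⁻¹ ^ r) := by
  have : CharP E 2 := charP_of_injective_algebraMap (algebraMap (ZMod 2) E).injective 2
  rw [aeval_revPoly_eq_sum (by rw [mul_comm, pow_mul, hβ, one_pow]), two_mul, sum_range_add,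
    ← sum_add_distrib]
  congr 1
  refine sum_congr rfl fun r _ => ?_
  rw [add_comm M r, ht, pow_add β⁻¹ r M, inv_pow β M, hβ, inv_one, mul_one, ← add_mul, map_add,
    ← add_assoc, CharTwo.add_self_eq_zero, zero_add]
  split_ifs <;> simp

end Geometric

/-! ### Odd parts and greatest common divisors -/

section Arithmetic

theorem two_pow_mul_oddPart (N : ℕ) : 2 ^ padicValNat 2 N * oddPart N = N :=
  Nat.mul_div_cancel' pow_padicValNat_dvd

theorem odd_oddPart {N : ℕ} (hN : 0 < N) : Odd (oddPart N) := by
  rw [← Nat.not_even_iff_odd, even_iff_two_dvd]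
  rintro ⟨k, hk⟩
  refine pow_succ_padicValNat_not_dvd (p := 2) hN.ne' ⟨k, ?_⟩
  conv_lhs => rw [← two_pow_mul_oddPart N, hk]
  ring

theorem dvd_posMod_iff {d n : ℕ} (hdn : d ∣ n) (hn : 0 < n) (a : ℤ) :
    d ∣ posMod a n ↔ (d : ℤ) ∣ a := by
  have hdn' : (d : ℤ) ∣ n := Int.natCast_dvd_natCast.2 hdn
  rw [posMod]
  split_ifs with h
  · exact ⟨fun _ => hdn'.trans (Int.dvd_of_emod_eq_zero h), fun _ => hdn⟩
  · rw [← Int.natCast_dvd_natCast,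
      Int.toNat_of_nonneg (Int.emod_nonneg a (by exact_mod_cast hn.ne'))]
    exact EuclideanDomain.dvd_mod_iff hdn'

/-- The `G N e`-th roots of unity are the roots of unity `β` of odd order dividing `N` for which
`β ^ (1 - 2 * e) = 1`. -/
theorem pow_G_eq_one_iff {E : Type*} [Field E] {N : ℕ} (hN : 0 < N) {β : E}
    (hβ : β ^ oddPart N = 1) (e : ℕ) : β ^ G N e = 1 ↔ β ^ (2 * e) = β := by
  have hodd := odd_oddPart hN
  have hβ0 : β ≠ 0 := by
    rintro rfl
    rw [zero_pow hodd.pos.ne'] at hβ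
    exact zero_ne_one hβ
  have hord := orderOf_dvd_of_pow_eq_one hβ
  rw [← orderOf_dvd_iff_pow_eq_one, G, Nat.dvd_gcd_iff, and_iff_right hord,
    dvd_posMod_iff hord hodd.pos, ← (IsPrimitiveRoot.orderOf β).zpow_eq_one_iff_dvd,
    zpow_add₀ hβ0, neg_mul, zpow_neg,
    zpow_one, inv_mul_eq_one₀ (zpow_ne_zero _ hβ0)]
  norm_cast

end Arithmetic

/-! ### The linear complexity of the interleaved sequence -/

/-- The exact linear complexity, `2 * N - G N e` with `N = 2 * M`. With `A` the polynomial of the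
first geometric sequence, the polynomial of the interleaved sequence takes the value
`(β + β ^ (2 * e)) * A (β ^ 2)` at every root `β` of `X ^ (2 * N) - 1`, and its derivative
takes the value `A (β ^ 2)`, which is not zero. -/
theorem linearComplexity_interleavedSeq {p : ℕ} [Fact p.Prime] (hp : 2 < p) {K : Type*} [Field K]
    [Fintype K] [Algebra (ZMod p) K] {ω : K} {M : ℕ} (hM : 0 < M)
    (hω : IsPrimitiveRoot ω (M * (p - 1))) (hcard : Fintype.card K = M * (p - 1) + 1) (e : ℕ) :
    linearComplexity (interleavedSeq p ω e) = 2 * (2 * M) - G (2 * M) e := by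
  have hN : 0 < 2 * M := by omega
  have h1 := geomSeqOne_add hp hM hω
  have h2 := geomSeqTwo_add hp hM hω
  have hper1 := periodic_of_add_eq hp hM hω h1
  have hper2 := periodic_of_add_eq hp hM hω h2
  have hodd := odd_oddPart hN
  have hGdvd : G (2 * M) e ∣ oddPart (2 * M) := Nat.gcd_dvd_left _ _
  have hoddM : oddPart (2 * M) ∣ M := by
    refine Nat.Coprime.dvd_of_dvd_mul_left (Nat.coprime_two_right.2 hodd)
      ⟨2 ^ padicValNat 2 (2 * M), ?_⟩
    rw [mul_comm (oddPart _), two_pow_mul_oddPart]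
  let E := AlgebraicClosure (ZMod 2)
  have : CharP E 2 := charP_of_injective_algebraMap (algebraMap (ZMod 2) E).injective 2
  -- in characteristic two, roots of unity have odd order
  have hpow : ∀ β : E, β ^ (2 * (2 * M)) = 1 → β ^ oddPart (2 * M) = 1 := by
    intro β hβ
    rw [← two_pow_mul_oddPart (2 * M), ← mul_assoc, ← pow_succ',
      ExpChar.pow_prime_pow_mul_eq_one_iff 2] at hβ
    exact hβ
  have hpowM : ∀ β : E, β ^ (2 * (2 * M)) = 1 → (β ^ 2) ^ M = 1 := by
    intro β hβ
    obtain ⟨k, hk⟩ := hoddM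
    rw [← pow_mul, hk, mul_left_comm, pow_mul, hpow β hβ, one_pow]
  have hne : ∀ β : E, β ^ (2 * (2 * M)) = 1 →
      aeval (β ^ 2) (revPoly (2 * M) (geomSeqOne p ω)) ≠ 0 := by
    intro β hβ
    have hβM := hpowM β hβ
    have hβ0 : β ^ 2 ≠ 0 := by
      intro h
      rw [h, zero_pow hM.ne'] at hβM
      exact zero_ne_one hβM
    rw [aeval_revPoly_of_add_eq h1 hβM]
    exact mul_ne_zero (inv_ne_zero hβ0)
      (sum_trace_support_ne_zero hp hω hcard (by rw [inv_pow, hβM, inv_one]))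
  refine linearComplexity_eq_sub_of_roots E (by omega) ?_ ?_ ?_ ?_ ?_
  · exact (hGdvd.trans hoddM).trans ⟨4, by ring⟩
  · rw [Ne, ZMod.natCast_eq_zero_iff, ← even_iff_two_dvd, Nat.not_even_iff_odd]
    exact hodd.of_dvd_nat hGdvd
  · refine periodic_interleave hper1 fun n => ?_
    change geomSeqTwo p ω (n + 2 * M + e) = geomSeqTwo p ω (n + e)
    rw [add_right_comm, hper2]
  · intro β hβ
    have hβM := hpowM β hβ
    have hβN : (β ^ 2) ^ (2 * M) = 1 := by rw [mul_comm 2 M, pow_mul, hβM, one_pow]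
    rw [pow_G_eq_one_iff hN (hpow β hβ), interleavedSeq, revPoly_interleave, map_add, map_mul,
      aeval_X, expand_aeval, expand_aeval, aeval_revPoly_leftShift hβN hper2,
      aeval_revPoly_of_add_eq h2 hβM, ← aeval_revPoly_of_add_eq h1 hβM, ← add_mul,
      mul_eq_zero, or_iff_left (hne β hβ), ← pow_mul, CharTwo.add_eq_zero, eq_comm]
  · intro β hβ
    rw [interleavedSeq, revPoly_interleave, derivative_add, derivative_mul, derivative_X,
      derivative_expand_two, derivative_expand_two, mul_zero, add_zero, add_zero, one_mul,
      expand_aeval]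
    exact hne β hβ

end InterleavedGeometric

theorem mainTheorem4 (p : ℕ) [Fact p.Prime] (hp : 2 < p) (m : ℕ) (hm : 1 < m)
    {K : Type*} [Field K] [Algebra (ZMod p) K] (hK : Nat.card K = p ^ m)
    (ω : K) (hω : IsPrimitiveRoot ω (p ^ m - 1))
    (N : ℕ) (hN : N = 2 * (p ^ m - 1) / (p - 1)) (e : ℕ) (he : e < N) :
    (InterleavedGeometric.linearComplexity (InterleavedGeometric.interleavedSeq p ω e)
        ≤ 2 * N - 1 ∧
      (InterleavedGeometric.linearComplexity (InterleavedGeometric.interleavedSeq p ω e)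
        = 2 * N - 1 ↔ InterleavedGeometric.G N e = 1)) ∧
    (2 * N - N / 2 ^ padicValNat 2 N
        ≤ InterleavedGeometric.linearComplexity (InterleavedGeometric.interleavedSeq p ω e) ∧
      (InterleavedGeometric.linearComplexity (InterleavedGeometric.interleavedSeq p ω e)
        = 2 * N - N / 2 ^ padicValNat 2 N ↔
          -2 * (e : ℤ) + 1 ≡ 0 [ZMOD ((N / 2 ^ padicValNat 2 N : ℕ) : ℤ)])) := by
  have hpm : 0 < p ^ m := pow_pos (by omega) m
  have : Finite K := Nat.finite_of_card_ne_zero (by omega)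
  have := Fintype.ofFinite K
  obtain ⟨M, hM⟩ : p - 1 ∣ p ^ m - 1 := Nat.sub_one_dvd_pow_sub_one p m
  rw [mul_comm] at hM
  have hNM : N = 2 * M := by
    rw [hN, hM, ← mul_assoc, Nat.mul_div_cancel _ (by omega)]
  subst hNM
  have hM0 : 0 < M := by omega
  rw [hM] at hω
  have hcard : Fintype.card K = M * (p - 1) + 1 := by
    rw [← Nat.card_eq_fintype_card, hK, ← hM]
    omega
  rw [InterleavedGeometric.linearComplexity_interleavedSeq hp hM0 hω hcard e]
  change (_ ∧ _) ∧ 2 * (2 * M) - InterleavedGeometric.oddPart (2 * M) ≤ _ ∧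
    (_ = 2 * (2 * M) - InterleavedGeometric.oddPart (2 * M) ↔
      _ ≡ 0 [ZMOD (InterleavedGeometric.oddPart (2 * M) : ℤ)])
  have hN0 : 0 < 2 * M := by omega
  have hodd := InterleavedGeometric.odd_oddPart hN0
  have hGdvd : InterleavedGeometric.G (2 * M) e ∣ InterleavedGeometric.oddPart (2 * M) :=
    Nat.gcd_dvd_left _ _
  have hGpos := Nat.pos_of_dvd_of_pos hGdvd hodd.pos
  have hGle := Nat.le_of_dvd hodd.pos hGdvd
  have hoddle : InterleavedGeometric.oddPart (2 * M) ≤ 2 * M := Nat.div_le_self _ _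
  have hmax : InterleavedGeometric.G (2 * M) e = InterleavedGeometric.oddPart (2 * M) ↔
      -2 * (e : ℤ) + 1 ≡ 0 [ZMOD (InterleavedGeometric.oddPart (2 * M) : ℤ)] := by
    rw [Int.modEq_zero_iff_dvd, ← InterleavedGeometric.dvd_posMod_iff dvd_rfl hodd.pos]
    exact Nat.gcd_eq_left_iff_dvd
  rw [← hmax]
  omega
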